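/- Let $\mathbb K$ be $\mathbb R$ or $\mathbb C$; sequences are indexed by $n\ge 0$ and have entries in $\mathbb K$, and a series $\sum_{j=0}^\infty$ is understood as the limit of its partial sums. Let $c_0$, $c$, $\ell_\infty$ be the sets of null, convergent and bounded sequences. Let $r,s,t$ be sequences with $r_n\neq 0$ and $t_n\ne 0$ for all $n$ and $s_0\neq 0$, and put $$c_0(r,s,t;\Delta)=\Big\{x:\ \Big(\tfrac1{r_n}\sum_{k=0}^n s_{n-k}t_k(x_k-x_{k-1})\Big)_{n}\in c_0\Big\},\qquad x_{-1}=0 .$$ For sets $U,V$ of sequences, an infinite matrix $A=(a_{nk})_{n,k\ge0}$ over $\mathbb K$ belongs to $(U,V)$ if for every $x\in U$ all the series $(Ax)_n=\sum_{k=0}^\infty a_{nk}x_k$ converge and $((Ax)_n)_n\in V$. Let $D^{(s)}_n=s_0^{-(n+1)}\det(h_{ij})_{1\le i,j\le n}$, where $h_{ij}=s_{i-j+1}$ if $j\le i+1$ and $h_{ij}=0$ otherwise (so $D_0^{(s)}=1/s_0$), and $$s_{jk}=\sum_{l=0}^{j-k}(-1)^l\frac{D^{(s)}_l}{t_{l+k}}\,r_k\quad(0\le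 k\le j),\qquad s_{jk}=0\quad (k>j),$$ which are the entries of the inverse of the triangle $x\mapsto\big(\frac1{r_n}\sum_{k=0}^n s_{n-k}t_k(x_k-x_{k-1})\big)_n$. For the rows $A_n=(a_{nj})_j$ of $A$ put $$R_k(A_n)=\sum_{j=0}^\infty s_{jk}a_{nj}=\sum_{j=k}^\infty s_{jk}a_{nj},\qquad w^{A_n}_{mk}=\sum_{j=m}^\infty a_{nj}s_{jk}\ \ (0\le k\le m),\qquad w^{A_n}_{mk}=0\ \ (k>m).$$ Consider the conditions (4.12) $\sup_n\sum_{k=0}^\infty|R_k(A_n)|<\infty$; (4.13) $\lim_{n\to\infty}R_k(A_n)=0$ for all $k$; (4.14) $\sup_m\sum_{k=0}^m|w^{A_n}_{mk}|<\infty$ for all $n$; (4.15) $\lim_{m\to\infty}w^{A_n}_{mk}=0$ for all $n,k$; (4.16) $\lim_{n\to\infty}R_k(A_n)$ exists for all $k$; each of them including the requirement that the series defining $R_k(A_n)$ converge for all $n,k$ (then so do those defining $w^{A_n}_{mk}$). Then: (a) $A\in(c_0(r,s,t;\Delta),c_0)$ if and only if (4.12), (4.13), (4.14) and (4.15) hold.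 (b) $A\in(c_0(r,s,t;\Delta),c)$ if and only if (4.12), (4.14), (4.15) and (4.16) hold. (c) $A\in(c_0(r,s,t;\Delta),\ell_\infty)$ if and only if (4.12), (4.14) and (4.15) hold. (d) Let $n,k\ge 0$ be such that the series $\sum_{j=0}^\infty a_{nj}$ and $\sum_{l=0}^\infty(-1)^l\frac{D^{(s)}_l}{t_{l+k}}\sum_{j=k+l}^\infty a_{nj}$ converge, and for $m\ge k$ put $$\tilde w_{m}=r_k\Big[\sum_{l=0}^{m-k}(-1)^l\frac{D_l^{(s)}}{t_{l+k}}\sum_{j=m}^\infty a_{nj}+\sum_{l=m-k+1}^\infty(-1)^l\frac{D_l^{(s)}}{t_{l+k}}\sum_{j=k+l}^\infty a_{nj}\Big].$$ If $\lim_{m\to\infty}\tilde w_m=0$, then the series defining $R_k(A_n)$ converges, $w^{A_n}_{mk}=\tilde w_m$ for all $m\ge k$, and $$R_k(A_n)=r_k\Big[\frac{a_{nk}}{s_0t_k}+\Big(\frac{D_0^{(s)}}{t_k}-\frac{D_1^{(s)}}{t_{k+1}}\Big)\sum_{j=k+1}^\infty a_{nj}+\sum_{l=2}^\infty(-1)^l\frac{D_l^{(s)}}{t_{l+k}}\sum_{j=k+l}^\infty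 a_{nj}\Big].$$ -/

import Mathlib

open Filter Topology
open scoped ENNReal

namespace GenMeans

variable {𝕜 : Type*} [RCLike 𝕜]

/-- Ordinary (conditional) convergence of the series `∑_{j=0}^∞ f j`: the partial sums converge. -/
def SeriesConv (f : ℕ → 𝕜) : Prop :=
  Summable f (SummationFilter.conditional ℕ)

/-- The sum `∑_{j=0}^∞ f j`, that is, the limit of the partial sums (when it exists). -/
noncomputable def seriesSum (f : ℕ → 𝕜) : 𝕜 :=
  tsum f (SummationFilter.conditional ℕ)

/-- Null sequences. -/
def c0 (𝕜 : Type*) [RCLike 𝕜] : Set (ℕ → 𝕜) :=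
  {x | Tendsto x atTop (𝓝 0)}

/-- Convergent sequences. -/
def c (𝕜 : Type*) [RCLike 𝕜] : Set (ℕ → 𝕜) :=
  {x | ∃ l : 𝕜, Tendsto x atTop (𝓝 l)}

/-- Bounded sequences. -/
def linf (𝕜 : Type*) [RCLike 𝕜] : Set (ℕ → 𝕜) :=
  {x | ∃ M : ℝ, ∀ n, ‖x n‖ ≤ M}

/-- The class `(U, V)` of infinite matrices mapping `U` into `V`: for every `x ∈ U` all the series
`(A x)_n = ∑_k a_{nk} x_k` converge and the sequence `A x` belongs to `V`. -/
def MapsInto (A : ℕ → ℕ → 𝕜) (U V : Set (ℕ → 𝕜)) : Prop :=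
  ∀ x ∈ U, (∀ n, SeriesConv fun k => A n k * x k) ∧
    (fun n => seriesSum fun k => A n k * x k) ∈ V

/-- The backward difference `Δ x_k = x_k - x_{k-1}`, with `x_{-1} = 0`. -/
def diff (x : ℕ → 𝕜) : ℕ → 𝕜
  | 0 => x 0
  | k + 1 => x (k + 1) - x k

/-- The sequence `A(r,s,t;Δ) x` of generalized means of `Δ x`. -/
noncomputable def mean (r s t : ℕ → 𝕜) (x : ℕ → 𝕜) (n : ℕ) : 𝕜 :=
  (1 / r n) * ∑ k ∈ Finset.range (n + 1), s (n - k) * t k * diff x k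

/-- The space `c_0(r,s,t;Δ)`. -/
def c0Mean (r s t : ℕ → 𝕜) : Set (ℕ → 𝕜) :=
  {x | mean r s t x ∈ c0 𝕜}

/-- `D_n^{(s)}`: the `n × n` determinant with `(i,j)` entry `s_{i-j+1}` (`0` above the
superdiagonal), divided by `s_0^{n+1}`; in particular `D_0^{(s)} = 1 / s_0`. -/
noncomputable def D (s : ℕ → 𝕜) (n : ℕ) : 𝕜 :=
  (1 / s 0 ^ (n + 1)) *
    (Matrix.of fun i j : Fin n =>
      if (j : ℕ) ≤ (i : ℕ) + 1 then s ((i : ℕ) + 1 - (j : ℕ)) else 0).det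

/-- The entry `s_{jk}` of the inverse `S` of the triangle `A(r,s,t;Δ)`. -/
noncomputable def invEntry (r s t : ℕ → 𝕜) (j k : ℕ) : 𝕜 :=
  if k ≤ j then
    ∑ l ∈ Finset.range (j - k + 1), (-1) ^ l * (D s l / t (l + k)) * r k
  else 0

/-- The series `R_k(a) = ∑_j s_{jk} a_j` converges for every `k`. -/
def RConv (r s t : ℕ → 𝕜) (a : ℕ → 𝕜) : Prop :=
  ∀ k, SeriesConv fun j => invEntry r s t j k * a j

/-- `R_k(a) = ∑_j s_{jk} a_j`, i.e. `R(a) = Sᵗ a`. -/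
noncomputable def R (r s t : ℕ → 𝕜) (a : ℕ → 𝕜) (k : ℕ) : 𝕜 :=
  seriesSum fun j => invEntry r s t j k * a j

/-- The triangle `W^a`: `w_{mk} = ∑_{j=m}^∞ a_j s_{jk}` for `k ≤ m`, and `0` for `k > m`. -/
noncomputable def W (r s t : ℕ → 𝕜) (a : ℕ → 𝕜) (m k : ℕ) : 𝕜 :=
  if k ≤ m then seriesSum fun i => a (m + i) * invEntry r s t (m + i) k else 0

/-- The tail `∑_{j=m}^∞ a_j`. -/
noncomputable def tail (a : ℕ → 𝕜) (m : ℕ) : 𝕜 :=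
  seriesSum fun i => a (m + i)

/-- The general term `(-1)^l (D_l^{(s)} / t_{l+k}) ∑_{j=k+l}^∞ a_j` of the rearranged series. -/
noncomputable def rearrTerm (s t : ℕ → 𝕜) (a : ℕ → 𝕜) (k l : ℕ) : 𝕜 :=
  (-1) ^ l * (D s l / t (l + k)) * tail a (k + l)

/-- The rearranged expression for `R_k(a)`. -/
noncomputable def RRearr (r s t : ℕ → 𝕜) (a : ℕ → 𝕜) (k : ℕ) : 𝕜 :=
  r k * (a k / (s 0 * t k) + (D s 0 / t k - D s 1 / t (k + 1)) * tail a (k + 1)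
    + seriesSum fun i => rearrTerm s t a k (i + 2))

/-- The rearranged expression for `w_{mk}`, `k ≤ m`. -/
noncomputable def WRearr (r s t : ℕ → 𝕜) (a : ℕ → 𝕜) (m k : ℕ) : 𝕜 :=
  r k * ((∑ l ∈ Finset.range (m - k + 1), (-1) ^ l * (D s l / t (l + k))) * tail a m
    + seriesSum fun i => rearrTerm s t a k (m - k + 1 + i))

/-- `sup_n ∑_k |R_k(A_n)| < ∞`. -/
def RRowsBounded (r s t : ℕ → 𝕜) (A : ℕ → ℕ → 𝕜) : Prop :=
  ⨆ n, ∑' k, ‖R r s t (A n) k‖ₑ < ∞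

/-- `lim_n R_k(A_n) = 0` for all `k`. -/
def RColsNull (r s t : ℕ → 𝕜) (A : ℕ → ℕ → 𝕜) : Prop :=
  ∀ k, Tendsto (fun n => R r s t (A n) k) atTop (𝓝 0)

/-- `lim_n R_k(A_n)` exists for all `k`. -/
def RColsConv (r s t : ℕ → 𝕜) (A : ℕ → ℕ → 𝕜) : Prop :=
  ∀ k, ∃ l : 𝕜, Tendsto (fun n => R r s t (A n) k) atTop (𝓝 l)

/-- `sup_m ∑_{k=0}^m |w_{mk}^{A_n}| < ∞` for all `n`. -/
def WRowsBounded (r s t : ℕ → 𝕜) (A : ℕ → ℕ → 𝕜) : Prop :=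
  ∀ n, ⨆ m, ∑ k ∈ Finset.range (m + 1), ‖W r s t (A n) m k‖ₑ < ∞

/-- `lim_m w_{mk}^{A_n} = 0` for all `n, k`. -/
def WColsNull (r s t : ℕ → 𝕜) (A : ℕ → ℕ → 𝕜) : Prop :=
  ∀ n k, Tendsto (fun m => W r s t (A n) m k) atTop (𝓝 0)

end GenMeans

namespace GenMeans

/-! ### Conditionally convergent series and their tails -/

section Series
variable {𝕜 : Type*} [RCLike 𝕜]

/-! The triangle defining the space is a bijection onto all sequences, so its elements are exactly
`x = S y` with `y` null. For a row `a` of `A`, exchanging finite sums turns the partial sums of `∑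
a_j x_j` into `∑_k P_{mk} y_k`, where `P_{mk}` is `partialR`, the `m`-th partial sum of the series
for `R_k(a)`. Unit vectors and Banach–Steinhaus show that these converge for every null `y` exactly
when the columns of `P` converge (to `R_k(a)`) and its rows are bounded in `ℓ¹`.

The stated conditions are a rewriting of this: for `k ≤ m` one has `P = R - W`, so bounded rows of
`P` amount to `R(a) ∈ ℓ¹` together with bounded rows of `W`. Columns of `W` are tails of convergent
series, hence null automatically.

Then `(A x)_n = ∑_k R_k(A_n) y_k`, and a second use of uniform boundedness, now over `n`, gives the
uniform `ℓ¹` bound for all three targets; these differ only in the column condition.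

The rearrangement formula is Abel summation: `WRearr` telescopes in `m`, with differences the terms
of the series for `R_k`. -/

theorem hasSum_conditional_iff {f : ℕ → 𝕜} {a : 𝕜} :
    HasSum f a (SummationFilter.conditional ℕ) ↔
      Tendsto (fun n => ∑ i ∈ Finset.range n, f i) atTop (𝓝 a) := by
  rw [HasSum, SummationFilter.conditional_filter_eq_map_range, tendsto_map'_iff]
  rfl

theorem seriesConv_iff {f : ℕ → 𝕜} :
    SeriesConv f ↔ ∃ a, Tendsto (fun n => ∑ i ∈ Finset.range n, f i) atTop (𝓝 a) := by
  simp only [SeriesConv, Summable, hasSum_conditional_iff]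

theorem SeriesConv.of_tendsto {f : ℕ → 𝕜} {a : 𝕜}
    (h : Tendsto (fun n => ∑ i ∈ Finset.range n, f i) atTop (𝓝 a)) : SeriesConv f :=
  seriesConv_iff.2 ⟨a, h⟩

theorem seriesSum_eq {f : ℕ → 𝕜} {a : 𝕜}
    (h : Tendsto (fun n => ∑ i ∈ Finset.range n, f i) atTop (𝓝 a)) : seriesSum f = a :=
  (hasSum_conditional_iff.2 h).tsum_eq

theorem SeriesConv.tendsto {f : ℕ → 𝕜} (h : SeriesConv f) :
    Tendsto (fun n => ∑ i ∈ Finset.range n, f i) atTop (𝓝 (seriesSum f)) :=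
  hasSum_conditional_iff.1 (Summable.hasSum h)

theorem SeriesConv.tendsto_shift {f : ℕ → 𝕜} (h : SeriesConv f) (m : ℕ) :
    Tendsto (fun n => ∑ i ∈ Finset.range n, f (m + i)) atTop
      (𝓝 (seriesSum f - ∑ i ∈ Finset.range m, f i)) := by
  have h1 := (h.tendsto.comp (tendsto_add_atTop_nat m)).sub_const (∑ i ∈ Finset.range m, f i)
  refine h1.congr fun n => ?_
  simp only [Function.comp_apply]
  rw [add_comm n m, Finset.sum_range_add, add_sub_cancel_left]

theorem SeriesConv.seriesSum_shift {f : ℕ → 𝕜} (h : SeriesConv f) (m : ℕ) :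
    (seriesSum fun i => f (m + i)) = seriesSum f - ∑ i ∈ Finset.range m, f i :=
  seriesSum_eq (h.tendsto_shift m)

theorem SeriesConv.seriesSum_eq_add {f : ℕ → 𝕜} (h : SeriesConv f) (m : ℕ) :
    (seriesSum fun i => f (m + i)) = f m + seriesSum fun i => f (m + 1 + i) := by
  rw [h.seriesSum_shift, h.seriesSum_shift, Finset.sum_range_succ]
  ring

end Series

/-! ### Absolutely summable rows acting on null sequences -/

section NullSequences
variable {𝕜 : Type*} [RCLike 𝕜]

theorem exists_norm_le_of_tendsto {y : ℕ → 𝕜} {l : 𝕜} (hy : Tendsto y atTop (𝓝 l)) :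
    ∃ M, 0 ≤ M ∧ ∀ n, ‖y n‖ ≤ M := by
  obtain ⟨M, hM⟩ := hy.norm.bddAbove_range
  exact ⟨M, (norm_nonneg _).trans (hM ⟨0, rfl⟩), fun n => hM ⟨n, rfl⟩⟩

theorem summable_norm_mul {b y : ℕ → 𝕜} {l : 𝕜} (hb : Summable fun k => ‖b k‖)
    (hy : Tendsto y atTop (𝓝 l)) : Summable fun k => ‖b k * y k‖ := by
  obtain ⟨M, _, hM⟩ := exists_norm_le_of_tendsto hy
  refine Summable.of_nonneg_of_le (fun _ => norm_nonneg _) (fun k => ?_) (hb.mul_right M)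
  rw [norm_mul]
  exact mul_le_mul_of_nonneg_left (hM k) (norm_nonneg _)

theorem tendsto_zeroAtInfty (f : ZeroAtInftyContinuousMap ℕ 𝕜) : Tendsto f atTop (𝓝 0) := by
  have := f.zero_at_infty'
  rwa [cocompact_eq_cofinite, Nat.cofinite_eq_atTop] at this

/-- The null sequence `y` as an element of the Banach space `c₀`. -/
def toZeroAtInfty (y : ℕ → 𝕜) (hy : Tendsto y atTop (𝓝 0)) : ZeroAtInftyContinuousMap ℕ 𝕜 where
  toFun := y
  continuous_toFun := continuous_of_discreteTopology
  zero_at_infty' := by rwa [cocompact_eq_cofinite, Nat.cofinite_eq_atTop]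

theorem norm_apply_le_norm (f : ZeroAtInftyContinuousMap ℕ 𝕜) (k : ℕ) : ‖f k‖ ≤ ‖f‖ := by
  rw [← ZeroAtInftyContinuousMap.norm_toBCF_eq_norm]
  exact f.toBCF.norm_coe_le_norm k

theorem norm_toZeroAtInfty_le {y : ℕ → 𝕜} (hy : Tendsto y atTop (𝓝 0)) {M : ℝ} (hM : 0 ≤ M)
    (h : ∀ k, ‖y k‖ ≤ M) : ‖toZeroAtInfty y hy‖ ≤ M := by
  rw [← ZeroAtInftyContinuousMap.norm_toBCF_eq_norm]
  exact (BoundedContinuousFunction.norm_le hM).2 h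

/-- The functional `y ↦ ∑ b_k y_k` on `c₀` given by an absolutely summable sequence `b`. -/
noncomputable def l1Functional (b : ℕ → 𝕜) (hb : Summable fun k => ‖b k‖) :
    ZeroAtInftyContinuousMap ℕ 𝕜 →L[𝕜] 𝕜 :=
  LinearMap.mkContinuous
    { toFun := fun f => ∑' k, b k * f k
      map_add' := fun f g => by
        rw [← Summable.tsum_add (summable_norm_mul hb (tendsto_zeroAtInfty f)).of_norm
          (summable_norm_mul hb (tendsto_zeroAtInfty g)).of_norm]
        simp [mul_add]
      map_smul' := fun c f => by
        simp only [ZeroAtInftyContinuousMap.smul_apply, smul_eq_mul, RingHom.id_apply]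
        rw [← tsum_mul_left]
        exact tsum_congr fun k => by ring }
    (∑' k, ‖b k‖) fun f => by
      have hs := summable_norm_mul hb (tendsto_zeroAtInfty f)
      refine (norm_tsum_le_tsum_norm hs).trans ?_
      rw [← tsum_mul_right]
      refine hs.tsum_le_tsum (fun k => ?_) (hb.mul_right _)
      rw [norm_mul]
      exact mul_le_mul_of_nonneg_left (norm_apply_le_norm f k) (norm_nonneg _)

@[simp]
theorem l1Functional_apply (b : ℕ → 𝕜) (hb : Summable fun k => ‖b k‖)
    (f : ZeroAtInftyContinuousMap ℕ 𝕜) : l1Functional b hb f = ∑' k, b k * f k := rfl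

/-- Test on the conjugate signs of `b`, cut off at `K` so that the test sequence is null. -/
theorem sum_norm_le_norm_l1Functional (b : ℕ → 𝕜) (hb : Summable fun k => ‖b k‖) (K : ℕ) :
    ∑ k ∈ Finset.range K, ‖b k‖ ≤ ‖l1Functional b hb‖ := by
  set y : ℕ → 𝕜 := fun k => if k < K then starRingEnd 𝕜 (b k) / (‖b k‖ : 𝕜) else 0 with hydef
  have hy : Tendsto y atTop (𝓝 0) := by
    refine tendsto_const_nhds.congr' ?_
    filter_upwards [eventually_ge_atTop K] with k hk
    simp [y, not_lt.2 hk]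
  have hy1 : ∀ k, ‖y k‖ ≤ 1 := by
    intro k
    simp only [y]
    split_ifs
    · rw [norm_div, RCLike.norm_conj, RCLike.norm_ofReal, abs_norm]
      exact div_self_le_one _
    · simp
  have hval : l1Functional b hb (toZeroAtInfty y hy) =
      ((∑ k ∈ Finset.range K, ‖b k‖ : ℝ) : 𝕜) := by
    rw [l1Functional_apply]
    change ∑' k, b k * y k = _
    rw [tsum_eq_sum (s := Finset.range K)
      fun k hk => by simp [y, not_lt.1 (by simpa using hk : ¬ k < K)]]
    rw [RCLike.ofReal_sum]
    refine Finset.sum_congr rfl fun k hk => ?_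
    simp only [y, if_pos (Finset.mem_range.1 hk)]
    by_cases h0 : b k = 0
    · simp [h0]
    · have : (‖b k‖ : 𝕜) ≠ 0 := by simpa using h0
      rw [mul_div_assoc', RCLike.mul_conj, div_eq_iff this, sq]
  have h1 := (l1Functional b hb).le_opNorm (toZeroAtInfty y hy)
  rw [hval, RCLike.norm_ofReal, abs_of_nonneg (Finset.sum_nonneg fun _ _ => norm_nonneg _)] at h1
  refine h1.trans (mul_le_of_le_one_right (norm_nonneg _) ?_)
  exact norm_toZeroAtInfty_le hy zero_le_one hy1

/-- Uniform boundedness for absolutely summable sequences acting on null sequences. -/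
theorem exists_sum_norm_le_of_pointwise_bounded {ι : Type*} (b : ι → ℕ → 𝕜)
    (hb : ∀ i, Summable fun k => ‖b i k‖)
    (h : ∀ y : ℕ → 𝕜, Tendsto y atTop (𝓝 0) → ∃ C : ℝ, ∀ i, ‖∑' k, b i k * y k‖ ≤ C) :
    ∃ C : ℝ, ∀ i K, ∑ k ∈ Finset.range K, ‖b i k‖ ≤ C := by
  obtain ⟨C, hC⟩ := banach_steinhaus (g := fun i => l1Functional (b i) (hb i))
    fun f => h f (tendsto_zeroAtInfty f)
  exact ⟨C, fun i K => (sum_norm_le_norm_l1Functional _ _ K).trans (hC i)⟩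

theorem summable_norm_of_sum_le {b : ℕ → 𝕜} {C : ℝ}
    (h : ∀ K, ∑ k ∈ Finset.range K, ‖b k‖ ≤ C) : Summable fun k => ‖b k‖ :=
  summable_of_sum_range_le (fun _ => norm_nonneg _) h

/-- Split at an index beyond which `y` is small: the head is a finite sum of null columns, and the
tail is controlled by the uniform row bound. -/
theorem tendsto_tsum_mul_zero {P : ℕ → ℕ → 𝕜} {C : ℝ}
    (hP : ∀ m K, ∑ k ∈ Finset.range K, ‖P m k‖ ≤ C)
    (hcol : ∀ k, Tendsto (fun m => P m k) atTop (𝓝 0)) {y : ℕ → 𝕜}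
    (hy : Tendsto y atTop (𝓝 0)) :
    Tendsto (fun m => ∑' k, P m k * y k) atTop (𝓝 0) := by
  have hC : 0 ≤ C := by simpa using hP 0 0
  rw [Metric.tendsto_atTop]
  intro ε hε
  -- `C + 1` rather than `C` keeps the denominator positive when `C = 0` and makes `C * δ < ε / 2`
  -- strict.
  set δ := ε / (2 * (C + 1)) with hδ
  have hδ0 : 0 < δ := by positivity
  obtain ⟨K, hK⟩ := Metric.tendsto_atTop.1 hy δ hδ0
  have hfin : Tendsto (fun m => ∑ k ∈ Finset.range K, ‖P m k * y k‖) atTop (𝓝 0) := by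
    have : Tendsto (fun m => ∑ k ∈ Finset.range K, ‖P m k * y k‖) atTop
        (𝓝 (∑ k ∈ Finset.range K, ‖(0 : 𝕜) * y k‖)) :=
      tendsto_finsetSum _ fun k _ => ((hcol k).mul_const (y k)).norm
    simpa using this
  obtain ⟨N, hN⟩ := Metric.tendsto_atTop.1 hfin (ε / 2) (by positivity)
  refine ⟨N, fun m hm => ?_⟩
  have hsum := summable_norm_mul (summable_norm_of_sum_le (hP m)) hy
  have hsP := summable_norm_of_sum_le (hP m)
  rw [dist_zero_right]
  have h1 : ∑ k ∈ Finset.range K, ‖P m k * y k‖ < ε / 2 := by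
    have := hN m hm
    rw [dist_zero_right, Real.norm_eq_abs] at this
    exact (le_abs_self _).trans_lt this
  have h2 : ∑' k, ‖P m (k + K) * y (k + K)‖ ≤ C * δ := by
    have hs' := (summable_nat_add_iff K).2 hsP
    calc ∑' k, ‖P m (k + K) * y (k + K)‖ ≤ ∑' k, ‖P m (k + K)‖ * δ := by
          refine ((summable_nat_add_iff K).2 hsum).tsum_le_tsum (fun k => ?_) (hs'.mul_right δ)
          rw [norm_mul]
          refine mul_le_mul_of_nonneg_left ?_ (norm_nonneg _)
          have := hK (k + K) (by omega)
          rw [dist_zero_right] at this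
          exact this.le
      _ = (∑' k, ‖P m (k + K)‖) * δ := tsum_mul_right
      _ ≤ C * δ := by
          refine mul_le_mul_of_nonneg_right ?_ hδ0.le
          have h3 := hsP.sum_add_tsum_nat_add K
          have h4 : ∑' k, ‖P m k‖ ≤ C := hsP.tsum_le_of_sum_range_le (hP m)
          have h5 : 0 ≤ ∑ k ∈ Finset.range K, ‖P m k‖ := Finset.sum_nonneg fun _ _ => norm_nonneg _
          linarith
  have h3 : C * δ < ε / 2 := by
    rw [hδ, mul_div_assoc', div_lt_div_iff₀ (by positivity) (by positivity)]
    nlinarith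
  calc ‖∑' k, P m k * y k‖ ≤ ∑' k, ‖P m k * y k‖ := norm_tsum_le_tsum_norm hsum
    _ = _ := (hsum.sum_add_tsum_nat_add K).symm
    _ < ε := by linarith

theorem sum_norm_le_of_tendsto {P : ℕ → ℕ → 𝕜} {p : ℕ → 𝕜} {C : ℝ}
    (hP : ∀ m K, ∑ k ∈ Finset.range K, ‖P m k‖ ≤ C)
    (hcol : ∀ k, Tendsto (fun m => P m k) atTop (𝓝 (p k))) (K : ℕ) :
    ∑ k ∈ Finset.range K, ‖p k‖ ≤ C :=
  le_of_tendsto (tendsto_finsetSum _ fun k _ => (hcol k).norm) (.of_forall fun m => hP m K)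

/-- A matrix with uniformly absolutely summable rows and convergent columns acts continuously on
null sequences. -/
theorem tendsto_tsum_mul {P : ℕ → ℕ → 𝕜} {p : ℕ → 𝕜} {C : ℝ}
    (hP : ∀ m K, ∑ k ∈ Finset.range K, ‖P m k‖ ≤ C)
    (hcol : ∀ k, Tendsto (fun m => P m k) atTop (𝓝 (p k))) {y : ℕ → 𝕜}
    (hy : Tendsto y atTop (𝓝 0)) :
    Tendsto (fun m => ∑' k, P m k * y k) atTop (𝓝 (∑' k, p k * y k)) := by
  have hp := sum_norm_le_of_tendsto hP hcol
  -- The limit row inherits the bound `C`, so the difference has null columns and row bound `C + C`.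
  have h0 : Tendsto (fun m => ∑' k, (P m k - p k) * y k) atTop (𝓝 0) := by
    refine tendsto_tsum_mul_zero (C := C + C) (fun m K => ?_) (fun k => ?_) hy
    · calc ∑ k ∈ Finset.range K, ‖P m k - p k‖
          ≤ ∑ k ∈ Finset.range K, (‖P m k‖ + ‖p k‖) :=
            Finset.sum_le_sum fun k _ => norm_sub_le _ _
        _ ≤ C + C := by rw [Finset.sum_add_distrib]; exact add_le_add (hP m K) (hp K)
    · simpa using (hcol k).sub_const (p k)
  have h1 := h0.add_const (∑' k, p k * y k)
  rw [zero_add] at h1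
  refine h1.congr fun m => ?_
  rw [← Summable.tsum_add]
  · exact tsum_congr fun k => by ring
  · simp only [sub_mul]
    exact (summable_norm_mul (summable_norm_of_sum_le (hP m)) hy).of_norm.sub
      (summable_norm_mul (summable_norm_of_sum_le hp) hy).of_norm
  · exact (summable_norm_mul (summable_norm_of_sum_le hp) hy).of_norm

end NullSequences
-- Inverting the triangle by power series
section Inverse
variable {𝕜 : Type*} [RCLike 𝕜]

/-- The lower triangular Toeplitz matrix with first column `f 0, …, f n`. -/
def toeplitz (f : ℕ → 𝕜) (n : ℕ) : Matrix (Fin (n + 1)) (Fin (n + 1)) 𝕜 :=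
  Matrix.of fun i j => if (j : ℕ) ≤ i then f (i - j) else 0

theorem det_toeplitz (s : ℕ → 𝕜) (n : ℕ) : (toeplitz s n).det = s 0 ^ (n + 1) := by
  rw [Matrix.det_of_isLowerTriangular]
  · simp [toeplitz]
  · intro i j hij
    have : (i : ℕ) < j := hij
    simp only [toeplitz, Matrix.of_apply, if_neg (not_le.2 this)]

/-- Deleting the first row and last column of the Toeplitz matrix leaves the Hessenberg matrix whose
determinant enters `D`. -/
theorem adjugate_toeplitz_last_zero (s : ℕ → 𝕜) (hs : s 0 ≠ 0) (n : ℕ) :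
    (toeplitz s n).adjugate (Fin.last n) 0 = s 0 ^ (n + 1) * ((-1) ^ n * D s n) := by
  rw [Matrix.adjugate_fin_succ_eq_det_submatrix]
  have : (toeplitz s n).submatrix (Fin.succAbove 0) (Fin.last n).succAbove =
      Matrix.of fun i j : Fin n =>
        if (j : ℕ) ≤ (i : ℕ) + 1 then s ((i : ℕ) + 1 - (j : ℕ)) else 0 := by
    ext i j
    simp only [Matrix.submatrix_apply, toeplitz, Matrix.of_apply, Fin.succAbove_zero,
      Fin.succAbove_last, Fin.val_succ, Fin.val_castSucc]
  rw [this, D]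
  have h0 : s 0 ^ (n + 1) ≠ 0 := pow_ne_zero _ hs
  simp only [Fin.val_zero, Fin.val_last, zero_add]
  field_simp

/-- Cramer's rule: the coefficients of the inverse series solve the Toeplitz system with right-hand
side the first unit vector, and the last unknown is read off from the adjugate. -/
theorem coeff_inv_eq (s : ℕ → 𝕜) (hs : s 0 ≠ 0) (n : ℕ) :
    PowerSeries.coeff n (PowerSeries.mk s)⁻¹ = (-1) ^ n * D s n := by
  have hinv : PowerSeries.mk s * (PowerSeries.mk s)⁻¹ = 1 :=
    PowerSeries.mul_inv_cancel _ (by simpa using hs)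
  set e : ℕ → 𝕜 := fun k => PowerSeries.coeff k (PowerSeries.mk s)⁻¹ with he
  have hvec : (toeplitz s n).mulVec (fun i => e i) = Pi.single 0 1 := by
    ext i
    have h1 := congrArg (PowerSeries.coeff (i : ℕ)) hinv
    rw [PowerSeries.coeff_mul, Finset.Nat.sum_antidiagonal_eq_sum_range_succ_mk,
      PowerSeries.coeff_one] at h1
    have h2 : (Pi.single 0 1 : Fin (n + 1) → 𝕜) i = if (i : ℕ) = 0 then 1 else 0 := by
      rw [Pi.single_apply]
      exact if_congr (by rw [Fin.ext_iff]; rfl) rfl rfl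
    rw [h2, ← h1, ← Finset.sum_range_reflect]
    simp only [Matrix.mulVec, dotProduct, toeplitz, Matrix.of_apply]
    rw [Fin.sum_univ_eq_sum_range (fun j => (if j ≤ (i : ℕ) then s (i - j) else 0) * e j) (n + 1)]
    refine (Finset.sum_subset (fun j hj => ?_) fun j _ hj => ?_).symm.trans
      (Finset.sum_congr rfl fun j hj => ?_)
    · have := Finset.mem_range.1 hj
      have := i.2
      exact Finset.mem_range.2 (by omega)
    · have : ¬ j ≤ (i : ℕ) := by
        have : ¬ j < (i : ℕ) + 1 := by simpa using hj
        omega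
      rw [if_neg this, zero_mul]
    · have hj' := Finset.mem_range.1 hj
      have h3 : j ≤ (i : ℕ) := by omega
      simp only [PowerSeries.coeff_mk, if_pos h3]
      rw [show (i : ℕ) + 1 - 1 - j = i - j by omega, show (i : ℕ) - (i - j) = j by omega]
  have h3 := congrArg (fun v => (toeplitz s n).adjugate.mulVec v (Fin.last n)) hvec
  simp only [Matrix.mulVec_mulVec, Matrix.adjugate_mul, det_toeplitz, Matrix.smul_mulVec,
    Matrix.one_mulVec, Pi.smul_apply, smul_eq_mul, Fin.val_last, Matrix.mulVec_single_one,
    Matrix.col_apply, adjugate_toeplitz_last_zero s hs] at h3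
  exact mul_left_cancel₀ (pow_ne_zero _ hs) h3

/-- The image of `y` under the triangle inverse to `mean r s t`. -/
noncomputable def invMean (r s t : ℕ → 𝕜) (y : ℕ → 𝕜) (j : ℕ) : 𝕜 :=
  ∑ k ∈ Finset.range (j + 1), invEntry r s t j k * y k

theorem invEntry_of_lt (r s t : ℕ → 𝕜) {j k : ℕ} (h : j < k) : invEntry r s t j k = 0 := by
  simp [invEntry, not_le.2 h]

/-- With `m = l + k` as outer index, `j` survives only as the upper limit; the summands are then the
backward differences of `invMean`. -/
theorem invMean_eq_sum (r s t : ℕ → 𝕜) (hs : s 0 ≠ 0) (y : ℕ → 𝕜) (j : ℕ) :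
    invMean r s t y j = ∑ k ∈ Finset.range (j + 1), 1 / t k *
      PowerSeries.coeff k ((PowerSeries.mk s)⁻¹ * PowerSeries.mk fun i => r i * y i) := by
  have hin : ∀ k ∈ Finset.range (j + 1), invEntry r s t j k * y k =
      ∑ m ∈ Finset.range (j + 1), if k ≤ m then
        1 / t m * ((-1) ^ (m - k) * D s (m - k) * (r k * y k)) else 0 := by
    intro k hk
    have hk' : k ≤ j := by simpa [Nat.lt_succ_iff] using hk
    rw [invEntry, if_pos hk', ← Finset.sum_filter, Finset.sum_mul]
    refine Finset.sum_nbij' (fun l => l + k) (fun m => m - k) ?_ ?_ ?_ ?_ ?_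
    · intro l hl; simp at hl ⊢; omega
    · intro l hl; simp at hl ⊢; omega
    · intro l hl; simp
    · intro l hl; simp at hl ⊢; omega
    · intro l hl
      simp only [Nat.add_sub_cancel]
      ring
  rw [invMean, Finset.sum_congr rfl hin, Finset.sum_comm]
  refine Finset.sum_congr rfl fun m hm => ?_
  rw [PowerSeries.coeff_mul, Finset.Nat.sum_antidiagonal_eq_sum_range_succ_mk, Finset.mul_sum,
    ← Finset.sum_filter, ← Finset.sum_range_reflect]
  have hm' := Finset.mem_range.1 hm
  have hf : (Finset.range (j + 1)).filter (fun k => k ≤ m) = Finset.range (m + 1) := by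
    ext k; simp; omega
  rw [hf]
  refine Finset.sum_congr rfl fun k hk => ?_
  have hk' := Finset.mem_range.1 hk
  rw [coeff_inv_eq s hs, PowerSeries.coeff_mk, Nat.succ_eq_add_one,
    show m + 1 - 1 - k = m - k by omega, show m - (m - k) = k by omega]

theorem sum_diff (x : ℕ → 𝕜) (j : ℕ) : ∑ k ∈ Finset.range (j + 1), diff x k = x j := by
  induction j with
  | zero => simp [diff]
  | succ j ih => rw [Finset.sum_range_succ, ih, diff]; ring

theorem diff_eq_of_sum {x z : ℕ → 𝕜} (h : ∀ j, x j = ∑ k ∈ Finset.range (j + 1), z k) :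
    diff x = z := by
  ext j
  cases j with
  | zero => simp [diff, h]
  | succ j => rw [diff, h, h, Finset.sum_range_succ _ (j + 1)]; ring

theorem mean_eq_coeff (r s t x : ℕ → 𝕜) (n : ℕ) :
    mean r s t x n = 1 / r n *
      PowerSeries.coeff n (PowerSeries.mk s * PowerSeries.mk fun k => t k * diff x k) := by
  rw [mean, PowerSeries.coeff_mul, Finset.Nat.sum_antidiagonal_eq_sum_range_succ_mk,
    ← Finset.sum_range_reflect]
  congr 1
  refine Finset.sum_congr rfl fun k hk => ?_
  have hk' := Finset.mem_range.1 hk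
  simp only [PowerSeries.coeff_mk]
  rw [Nat.succ_eq_add_one] at hk'
  rw [show n + 1 - 1 - k = n - k by omega, show n - (n - k) = k by omega, mul_assoc]

theorem mean_invMean {r s t : ℕ → 𝕜} (hr : ∀ n, r n ≠ 0) (ht : ∀ n, t n ≠ 0) (hs : s 0 ≠ 0)
    (y : ℕ → 𝕜) : mean r s t (invMean r s t y) = y := by
  ext n
  have hd : (PowerSeries.mk fun k => t k * diff (invMean r s t y) k) =
      (PowerSeries.mk s)⁻¹ * PowerSeries.mk fun i => r i * y i := by
    ext k
    rw [diff_eq_of_sum (invMean_eq_sum r s t hs y), PowerSeries.coeff_mk, ← mul_assoc,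
      mul_one_div_cancel (ht k), one_mul]
  rw [mean_eq_coeff, hd, ← mul_assoc, PowerSeries.mul_inv_cancel _ (by simpa using hs), one_mul,
    PowerSeries.coeff_mk, ← mul_assoc, one_div_mul_cancel (hr n), one_mul]

theorem invMean_mean {r s t : ℕ → 𝕜} (hr : ∀ n, r n ≠ 0) (ht : ∀ n, t n ≠ 0) (hs : s 0 ≠ 0)
    (x : ℕ → 𝕜) : invMean r s t (mean r s t x) = x := by
  ext j
  have hm : (PowerSeries.mk fun i => r i * mean r s t x i) =
      PowerSeries.mk s * PowerSeries.mk fun k => t k * diff x k := by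
    ext n
    rw [PowerSeries.coeff_mk, mean_eq_coeff, ← mul_assoc, mul_one_div_cancel (hr n), one_mul]
  rw [invMean_eq_sum r s t hs, hm, ← mul_assoc,
    PowerSeries.inv_mul_cancel _ (by simpa using hs), one_mul, ← sum_diff x j]
  refine Finset.sum_congr rfl fun k _ => ?_
  rw [PowerSeries.coeff_mk, ← mul_assoc, one_div_mul_cancel (ht k), one_mul]

theorem mapsInto_c0Mean_iff {r s t : ℕ → 𝕜} (hr : ∀ n, r n ≠ 0) (ht : ∀ n, t n ≠ 0)
    (hs : s 0 ≠ 0) (A : ℕ → ℕ → 𝕜) (V : Set (ℕ → 𝕜)) :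
    MapsInto A (c0Mean r s t) V ↔ ∀ y : ℕ → 𝕜, Tendsto y atTop (𝓝 0) →
      (∀ n, SeriesConv fun k => A n k * invMean r s t y k) ∧
        (fun n => seriesSum fun k => A n k * invMean r s t y k) ∈ V := by
  constructor
  · intro h y hy
    refine h _ ?_
    change Tendsto (mean r s t (invMean r s t y)) atTop (𝓝 0)
    rwa [mean_invMean hr ht hs]
  · intro h x hx
    have := h _ hx
    rwa [invMean_mean hr ht hs] at this

end Inverse
-- Rows, their partial sums, and the mapping classes
section Rows
variable {𝕜 : Type*} [RCLike 𝕜]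

/-- The partial sum `∑_{j<m} s_{jk} a_j` of the series `R_k(a)`. -/
noncomputable def partialR (r s t a : ℕ → 𝕜) (m k : ℕ) : 𝕜 :=
  ∑ j ∈ Finset.range m, invEntry r s t j k * a j

theorem partialR_of_le (r s t a : ℕ → 𝕜) {m k : ℕ} (h : m ≤ k) : partialR r s t a m k = 0 :=
  Finset.sum_eq_zero fun j hj => by
    rw [invEntry_of_lt r s t ((Finset.mem_range.1 hj).trans_le h), zero_mul]

theorem sum_mul_invMean (r s t a y : ℕ → 𝕜) (m : ℕ) :
    ∑ j ∈ Finset.range m, a j * invMean r s t y j = ∑' k, partialR r s t a m k * y k := by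
  rw [tsum_eq_sum (s := Finset.range m) fun k hk => by
    rw [partialR_of_le r s t a (by simpa using hk), zero_mul]]
  simp only [partialR, Finset.sum_mul]
  rw [Finset.sum_comm]
  refine Finset.sum_congr rfl fun j hj => ?_
  have hj' := Finset.mem_range.1 hj
  rw [invMean, Finset.mul_sum]
  rw [Finset.sum_subset (Finset.range_subset_range.2 (show j + 1 ≤ m by omega))]
  · exact Finset.sum_congr rfl fun k _ => by ring
  · intro k _ hk
    rw [invEntry_of_lt r s t (by simpa [Nat.succ_le_iff] using hk)]
    ring

theorem tendsto_single_zero (k : ℕ) : Tendsto (Pi.single k (1 : 𝕜) : ℕ → 𝕜) atTop (𝓝 0) := by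
  refine tendsto_const_nhds.congr' ?_
  filter_upwards [eventually_gt_atTop k] with j hj
  rw [Pi.single_eq_of_ne hj.ne']

theorem tsum_mul_single (b : ℕ → 𝕜) (k : ℕ) :
    ∑' i, b i * (Pi.single k (1 : 𝕜) : ℕ → 𝕜) i = b k := by
  rw [tsum_eq_single k fun i hi => by rw [Pi.single_eq_of_ne hi, mul_zero], Pi.single_eq_same,
    mul_one]

theorem summable_norm_partialR (r s t a : ℕ → 𝕜) (m : ℕ) :
    Summable fun k => ‖partialR r s t a m k‖ :=
  summable_of_ne_finset_zero (s := Finset.range m) fun k hk => by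
    rw [partialR_of_le r s t a (by simpa using hk), norm_zero]

/-- Testing on the `k`-th unit vector recovers the series for `R_k`. -/
theorem rConv_of_seriesConv {r s t a : ℕ → 𝕜}
    (h : ∀ y : ℕ → 𝕜, Tendsto y atTop (𝓝 0) → SeriesConv fun j => a j * invMean r s t y j) :
    RConv r s t a := fun k => by
  obtain ⟨l, hl⟩ := seriesConv_iff.1 (h _ (tendsto_single_zero k))
  refine .of_tendsto (hl.congr fun m => ?_)
  rw [sum_mul_invMean, tsum_mul_single, partialR]

theorem partialR_bounded_of_seriesConv {r s t a : ℕ → 𝕜}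
    (h : ∀ y : ℕ → 𝕜, Tendsto y atTop (𝓝 0) → SeriesConv fun j => a j * invMean r s t y j) :
    ∃ C : ℝ, ∀ m K, ∑ k ∈ Finset.range K, ‖partialR r s t a m k‖ ≤ C := by
  refine exists_sum_norm_le_of_pointwise_bounded _ (summable_norm_partialR r s t a) fun y hy => ?_
  obtain ⟨M, -, hM⟩ := exists_norm_le_of_tendsto (h y hy).tendsto
  exact ⟨M, fun m => by rw [← sum_mul_invMean]; exact hM m⟩

theorem RConv.tendsto_partialR {r s t a : ℕ → 𝕜} (h : RConv r s t a) (k : ℕ) :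
    Tendsto (fun m => partialR r s t a m k) atTop (𝓝 (R r s t a k)) :=
  (h k).tendsto

theorem RConv.tendsto_sum_mul_invMean {r s t a : ℕ → 𝕜} (h : RConv r s t a) {C : ℝ}
    (hC : ∀ m K, ∑ k ∈ Finset.range K, ‖partialR r s t a m k‖ ≤ C) {y : ℕ → 𝕜}
    (hy : Tendsto y atTop (𝓝 0)) :
    Tendsto (fun m => ∑ j ∈ Finset.range m, a j * invMean r s t y j) atTop
      (𝓝 (∑' k, R r s t a k * y k)) := by
  simp only [sum_mul_invMean]
  exact tendsto_tsum_mul hC h.tendsto_partialR hy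

theorem RConv.W_eq {r s t a : ℕ → 𝕜} (h : RConv r s t a) {m k : ℕ} (hk : k ≤ m) :
    W r s t a m k = R r s t a k - partialR r s t a m k := by
  rw [W, if_pos hk, R, partialR, ← (h k).seriesSum_shift m]
  simp only [mul_comm]

theorem RConv.tendsto_W {r s t a : ℕ → 𝕜} (h : RConv r s t a) (k : ℕ) :
    Tendsto (fun m => W r s t a m k) atTop (𝓝 0) := by
  have h1 := (h.tendsto_partialR k).const_sub (R r s t a k)
  rw [sub_self] at h1
  refine h1.congr' ?_
  filter_upwards [eventually_ge_atTop k] with m hm using (h.W_eq hm).symm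

/-- The triangle inequality in `R = partialR + W` for `k ≤ m`; for `k > m` both `partialR` and `W`
vanish. -/
theorem RConv.partialR_bounded_iff {r s t a : ℕ → 𝕜} (h : RConv r s t a) :
    (∃ C : ℝ, ∀ m K, ∑ k ∈ Finset.range K, ‖partialR r s t a m k‖ ≤ C) ↔
      (Summable fun k => ‖R r s t a k‖) ∧
        ∃ C : ℝ, ∀ m, ∑ k ∈ Finset.range (m + 1), ‖W r s t a m k‖ ≤ C := by
  constructor
  · rintro ⟨C, hC⟩
    have hR := sum_norm_le_of_tendsto hC h.tendsto_partialR
    refine ⟨summable_norm_of_sum_le hR, C + C, fun m => ?_⟩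
    calc ∑ k ∈ Finset.range (m + 1), ‖W r s t a m k‖
        ≤ ∑ k ∈ Finset.range (m + 1), (‖R r s t a k‖ + ‖partialR r s t a m k‖) := by
          refine Finset.sum_le_sum fun k hk => ?_
          rw [h.W_eq (Nat.lt_succ_iff.1 (Finset.mem_range.1 hk))]
          exact norm_sub_le _ _
      _ ≤ C + C := by rw [Finset.sum_add_distrib]; exact add_le_add (hR _) (hC _ _)
  · rintro ⟨hR, C, hC⟩
    refine ⟨∑' k, ‖R r s t a k‖ + C, fun m K => ?_⟩
    calc ∑ k ∈ Finset.range K, ‖partialR r s t a m k‖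
        ≤ ∑ k ∈ Finset.range K, (‖R r s t a k‖ + ‖W r s t a m k‖) := by
          refine Finset.sum_le_sum fun k _ => ?_
          rcases le_or_gt k m with hk | hk
          · rw [show partialR r s t a m k = R r s t a k - W r s t a m k by rw [h.W_eq hk]; ring]
            exact norm_sub_le _ _
          · rw [partialR_of_le r s t a hk.le, norm_zero]
            positivity
      _ ≤ ∑' k, ‖R r s t a k‖ + C := by
          rw [Finset.sum_add_distrib]
          refine add_le_add (hR.sum_le_tsum _ fun _ _ => norm_nonneg _) (le_trans ?_ (hC m))
          -- `K` may exceed `m + 1`; the sum of `W` is extended by zeros to `max K (m + 1)` to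
          -- compare the two ranges.
          rw [Finset.sum_subset (Finset.range_subset_range.2 (le_max_right K (m + 1)))
            fun k _ hk => by rw [W, if_neg (by simpa [Nat.lt_succ_iff] using hk), norm_zero]]
          exact Finset.sum_le_sum_of_subset_of_nonneg
            (Finset.range_subset_range.2 (le_max_left K (m + 1))) fun _ _ _ => norm_nonneg _

theorem iSup_ofReal_lt_top_iff {ι : Type*} {u : ι → ℝ} :
    ⨆ i, ENNReal.ofReal (u i) < ∞ ↔ ∃ C : ℝ, ∀ i, u i ≤ C := by
  constructor
  · intro h
    refine ⟨(⨆ i, ENNReal.ofReal (u i)).toReal, fun i => ?_⟩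
    exact (ENNReal.ofReal_le_iff_le_toReal h.ne).1 (le_iSup (fun i => ENNReal.ofReal (u i)) i)
  · rintro ⟨C, hC⟩
    exact (iSup_le fun i => ENNReal.ofReal_le_ofReal (hC i)).trans_lt ENNReal.ofReal_lt_top

theorem sum_enorm_eq_ofReal (f : ℕ → 𝕜) (S : Finset ℕ) :
    ∑ k ∈ S, ‖f k‖ₑ = ENNReal.ofReal (∑ k ∈ S, ‖f k‖) := by
  rw [ENNReal.ofReal_sum_of_nonneg fun _ _ => norm_nonneg _]
  simp only [ofReal_norm]

/-- An extended nonnegative series is the supremum of its partial sums, so both suprema merge into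
one over pairs `(n, K)`. -/
theorem rRowsBounded_iff (r s t : ℕ → 𝕜) (A : ℕ → ℕ → 𝕜) :
    RRowsBounded r s t A ↔ ∃ C : ℝ, ∀ n K, ∑ k ∈ Finset.range K, ‖R r s t (A n) k‖ ≤ C := by
  have : (⨆ n, ∑' k, ‖R r s t (A n) k‖ₑ) =
      ⨆ p : ℕ × ℕ, ENNReal.ofReal (∑ k ∈ Finset.range p.2, ‖R r s t (A p.1) k‖) := by
    rw [iSup_prod]
    simp only [ENNReal.tsum_eq_iSup_nat, sum_enorm_eq_ofReal]
  rw [RRowsBounded, this, iSup_ofReal_lt_top_iff]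
  simp only [Prod.forall]

theorem wRowsBounded_iff (r s t : ℕ → 𝕜) (A : ℕ → ℕ → 𝕜) :
    WRowsBounded r s t A ↔
      ∀ n, ∃ C : ℝ, ∀ m, ∑ k ∈ Finset.range (m + 1), ‖W r s t (A n) m k‖ ≤ C := by
  simp only [WRowsBounded, sum_enorm_eq_ofReal, iSup_ofReal_lt_top_iff]

theorem wColsNull_of_rConv {r s t : ℕ → 𝕜} {A : ℕ → ℕ → 𝕜} (h : ∀ n, RConv r s t (A n)) :
    WColsNull r s t A := fun n k => (h n).tendsto_W k

/-- Each row of `A` lies in the `β`-dual of `c_0(r,s,t;Δ)` and the transformed matrix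
`(R_k(A_n))` maps null sequences into `V`. -/
theorem mapsInto_iff_R {r s t : ℕ → 𝕜} (hr : ∀ n, r n ≠ 0) (ht : ∀ n, t n ≠ 0) (hs : s 0 ≠ 0)
    (A : ℕ → ℕ → 𝕜) (V : Set (ℕ → 𝕜)) :
    MapsInto A (c0Mean r s t) V ↔ (∀ n, RConv r s t (A n)) ∧
      (∀ n, Summable fun k => ‖R r s t (A n) k‖) ∧ WRowsBounded r s t A ∧
      ∀ y : ℕ → 𝕜, Tendsto y atTop (𝓝 0) → (fun n => ∑' k, R r s t (A n) k * y k) ∈ V := by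
  rw [mapsInto_c0Mean_iff hr ht hs, wRowsBounded_iff]
  constructor
  · intro h
    have hR : ∀ n, RConv r s t (A n) := fun n => rConv_of_seriesConv fun y hy => (h y hy).1 n
    have hB := fun n => partialR_bounded_of_seriesConv fun y hy => (h y hy).1 n
    have hRW := fun n => (hR n).partialR_bounded_iff.1 (hB n)
    refine ⟨hR, fun n => (hRW n).1, fun n => (hRW n).2, fun y hy => ?_⟩
    convert (h y hy).2 using 2 with n
    obtain ⟨C, hC⟩ := hB n
    exact (seriesSum_eq ((hR n).tendsto_sum_mul_invMean hC hy)).symm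
  · rintro ⟨hR, hS, hW, hV⟩ y hy
    have hlim : ∀ n, Tendsto (fun m => ∑ j ∈ Finset.range m, A n j * invMean r s t y j) atTop
        (𝓝 (∑' k, R r s t (A n) k * y k)) := fun n => by
      obtain ⟨C, hC⟩ := (hR n).partialR_bounded_iff.2 ⟨hS n, hW n⟩
      exact (hR n).tendsto_sum_mul_invMean hC hy
    refine ⟨fun n => .of_tendsto (hlim n), ?_⟩
    convert hV y hy using 2 with n
    exact seriesSum_eq (hlim n)

theorem c0_subset_c : c0 𝕜 ⊆ c 𝕜 := fun _ hx => ⟨0, hx⟩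

theorem c_subset_linf : c 𝕜 ⊆ linf 𝕜 := fun x ⟨_, hl⟩ => by
  obtain ⟨M, -, hM⟩ := exists_norm_le_of_tendsto hl
  exact ⟨M, hM⟩

/-- Uniform boundedness over `n` upgrades summability of each row of `R` to a common bound once the
images are bounded sequences. -/
theorem mapsInto_iff_of_subset_linf {r s t : ℕ → 𝕜} (hr : ∀ n, r n ≠ 0) (ht : ∀ n, t n ≠ 0)
    (hs : s 0 ≠ 0) (A : ℕ → ℕ → 𝕜) {V : Set (ℕ → 𝕜)} (hV : V ⊆ linf 𝕜) :
    MapsInto A (c0Mean r s t) V ↔ (∀ n, RConv r s t (A n)) ∧ RRowsBounded r s t A ∧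
      WRowsBounded r s t A ∧
      ∀ y : ℕ → 𝕜, Tendsto y atTop (𝓝 0) → (fun n => ∑' k, R r s t (A n) k * y k) ∈ V := by
  rw [mapsInto_iff_R hr ht hs, rRowsBounded_iff]
  constructor
  · rintro ⟨hR, hS, hW, h⟩
    exact ⟨hR, exists_sum_norm_le_of_pointwise_bounded _ hS fun y hy => hV (h y hy), hW, h⟩
  · rintro ⟨hR, ⟨C, hC⟩, hW, h⟩
    exact ⟨hR, fun n => summable_norm_of_sum_le (hC n), hW, h⟩

theorem mapsInto_c0_iff {r s t : ℕ → 𝕜} (hr : ∀ n, r n ≠ 0) (ht : ∀ n, t n ≠ 0)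
    (hs : s 0 ≠ 0) (A : ℕ → ℕ → 𝕜) :
    MapsInto A (c0Mean r s t) (c0 𝕜) ↔ (∀ n, RConv r s t (A n)) ∧ RRowsBounded r s t A ∧
      RColsNull r s t A ∧ WRowsBounded r s t A ∧ WColsNull r s t A := by
  rw [mapsInto_iff_of_subset_linf hr ht hs A (c0_subset_c.trans c_subset_linf)]
  constructor
  · rintro ⟨hR, hB, hW, h⟩
    refine ⟨hR, hB, fun k => ?_, hW, wColsNull_of_rConv hR⟩
    have := h _ (tendsto_single_zero k)
    simp only [tsum_mul_single] at this
    exact this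
  · rintro ⟨hR, hB, h0, hW, -⟩
    obtain ⟨C, hC⟩ := (rRowsBounded_iff r s t A).1 hB
    exact ⟨hR, hB, hW, fun y hy => tendsto_tsum_mul_zero hC h0 hy⟩

theorem mapsInto_c_iff {r s t : ℕ → 𝕜} (hr : ∀ n, r n ≠ 0) (ht : ∀ n, t n ≠ 0)
    (hs : s 0 ≠ 0) (A : ℕ → ℕ → 𝕜) :
    MapsInto A (c0Mean r s t) (c 𝕜) ↔ (∀ n, RConv r s t (A n)) ∧ RRowsBounded r s t A ∧
      WRowsBounded r s t A ∧ WColsNull r s t A ∧ RColsConv r s t A := by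
  rw [mapsInto_iff_of_subset_linf hr ht hs A c_subset_linf]
  constructor
  · rintro ⟨hR, hB, hW, h⟩
    refine ⟨hR, hB, hW, wColsNull_of_rConv hR, fun k => ?_⟩
    have := h _ (tendsto_single_zero k)
    simp only [tsum_mul_single] at this
    exact this
  · rintro ⟨hR, hB, hW, -, hc⟩
    obtain ⟨C, hC⟩ := (rRowsBounded_iff r s t A).1 hB
    choose l hl using hc
    exact ⟨hR, hB, hW, fun y hy => ⟨_, tendsto_tsum_mul hC hl hy⟩⟩

theorem mapsInto_linf_iff {r s t : ℕ → 𝕜} (hr : ∀ n, r n ≠ 0) (ht : ∀ n, t n ≠ 0)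
    (hs : s 0 ≠ 0) (A : ℕ → ℕ → 𝕜) :
    MapsInto A (c0Mean r s t) (linf 𝕜) ↔ (∀ n, RConv r s t (A n)) ∧ RRowsBounded r s t A ∧
      WRowsBounded r s t A ∧ WColsNull r s t A := by
  rw [mapsInto_iff_of_subset_linf hr ht hs A subset_rfl]
  constructor
  · rintro ⟨hR, hB, hW, -⟩
    exact ⟨hR, hB, hW, wColsNull_of_rConv hR⟩
  · rintro ⟨hR, hB, hW, -⟩
    refine ⟨hR, hB, hW, fun y hy => ?_⟩
    obtain ⟨C, hC⟩ := (rRowsBounded_iff r s t A).1 hB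
    obtain ⟨M, hM0, hM⟩ := exists_norm_le_of_tendsto hy
    refine ⟨C * M, fun n => ?_⟩
    have hS := summable_norm_of_sum_le (hC n)
    have hSy := summable_norm_mul hS hy
    calc ‖∑' k, R r s t (A n) k * y k‖ ≤ ∑' k, ‖R r s t (A n) k * y k‖ :=
          norm_tsum_le_tsum_norm hSy
      _ ≤ ∑' k, ‖R r s t (A n) k‖ * M := hSy.tsum_le_tsum (fun k => by
          rw [norm_mul]; exact mul_le_mul_of_nonneg_left (hM k) (norm_nonneg _)) (hS.mul_right M)
      _ = (∑' k, ‖R r s t (A n) k‖) * M := tsum_mul_right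
      _ ≤ C * M := mul_le_mul_of_nonneg_right (hS.tsum_le_of_sum_range_le (hC n)) hM0

end Rows

/-! ### Abel summation for the rearranged formulas -/

section Rearrangement
variable {𝕜 : Type*} [RCLike 𝕜]

/-- Summation by parts, one step at a time. -/
theorem WRearr_sub_succ {r s t a : ℕ → 𝕜} {k j : ℕ} (ha : SeriesConv a)
    (hrearr : SeriesConv (rearrTerm s t a k)) (hj : k ≤ j) :
    WRearr r s t a j k - WRearr r s t a (j + 1) k = invEntry r s t j k * a j := by
  obtain ⟨i, rfl⟩ := Nat.exists_eq_add_of_le hj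
  have h1 := hrearr.seriesSum_eq_add (i + 1)
  have h2 : tail a (k + i) = a (k + i) + tail a (k + i + 1) := ha.seriesSum_eq_add (k + i)
  have h3 : rearrTerm s t a k (i + 1) =
      (-1) ^ (i + 1) * (D s (i + 1) / t (i + 1 + k)) * tail a (k + i + 1) := rfl
  -- The term `l = i + 1` passes from the series to the finite sum, so every multiple of the tail at
  -- `j + 1` cancels and only `a j` remains.
  rw [invEntry, if_pos hj, ← Finset.sum_mul, WRearr, WRearr,
    show k + i - k + 1 = i + 1 by omega, show k + i + 1 - k + 1 = i + 1 + 1 by omega,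
    h1, h2, h3, Finset.sum_range_succ _ (i + 1)]
  ring

theorem sum_invEntry_mul {r s t a : ℕ → 𝕜} {k m : ℕ} (ha : SeriesConv a)
    (hrearr : SeriesConv (rearrTerm s t a k)) (hm : k ≤ m) :
    ∑ j ∈ Finset.range m, invEntry r s t j k * a j =
      WRearr r s t a k k - WRearr r s t a m k := by
  induction m, hm using Nat.le_induction with
  | base =>
    rw [sub_self]
    exact partialR_of_le r s t a le_rfl
  | succ m hm ih =>
    rw [Finset.sum_range_succ, ih, ← WRearr_sub_succ ha hrearr hm]
    ring

/-- Split `a k` off the tail in the `l = 0` term, using `D s 0 = 1 / s 0`, and merge the `l = 1`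
term into the coefficient of the next tail. -/
theorem WRearr_self_eq_RRearr {r s t a : ℕ → 𝕜} {k : ℕ} (ha : SeriesConv a)
    (hrearr : SeriesConv (rearrTerm s t a k)) :
    WRearr r s t a k k = RRearr r s t a k := by
  have h1 := hrearr.seriesSum_eq_add 1
  have h2 : tail a k = a k + tail a (k + 1) := ha.seriesSum_eq_add k
  have h3 : rearrTerm s t a k 1 = (-1) ^ 1 * (D s 1 / t (1 + k)) * tail a (k + 1) := rfl
  have h4 : a k / (s 0 * t k) = D s 0 / t k * a k := by
    simp only [D, Matrix.det_fin_zero, zero_add, pow_one, mul_one]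
    rw [div_div, one_div_mul_eq_div]
  rw [WRearr, RRearr, Nat.sub_self, zero_add, h1, h2, h3, h4, Finset.sum_range_one, zero_add,
    add_comm 1 k]
  simp only [add_comm _ 2]
  ring_nf

theorem rearrangement {r s t a : ℕ → 𝕜} {k : ℕ} (ha : SeriesConv a)
    (hrearr : SeriesConv (rearrTerm s t a k))
    (hlim : Tendsto (fun m => WRearr r s t a m k) atTop (𝓝 0)) :
    (SeriesConv fun j => invEntry r s t j k * a j) ∧ R r s t a k = RRearr r s t a k ∧
      ∀ m, k ≤ m → W r s t a m k = WRearr r s t a m k := by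
  have hT : Tendsto (fun m => ∑ j ∈ Finset.range m, invEntry r s t j k * a j) atTop
      (𝓝 (WRearr r s t a k k)) := by
    have h1 := hlim.const_sub (WRearr r s t a k k)
    rw [sub_zero] at h1
    refine h1.congr' ?_
    filter_upwards [eventually_ge_atTop k] with m hm using (sum_invEntry_mul ha hrearr hm).symm
  have hc : SeriesConv fun j => invEntry r s t j k * a j := .of_tendsto hT
  refine ⟨hc, (seriesSum_eq hT).trans (WRearr_self_eq_RRearr ha hrearr), fun m hm => ?_⟩
  -- The full sum is `WRearr` at `m = k`; removing the telescoped partial sum leaves `WRearr` at `m`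
  -- as the tail.
  have h2 := hc.seriesSum_shift m
  rw [sum_invEntry_mul ha hrearr hm, seriesSum_eq hT, sub_sub_cancel] at h2
  rw [W, if_pos hm, ← h2]
  simp only [mul_comm]

end Rearrangement
end GenMeans

theorem theorem4p11 {𝕜 : Type*} [RCLike 𝕜] (r s t : ℕ → 𝕜)
    (hr : ∀ n, r n ≠ 0) (ht : ∀ n, t n ≠ 0) (hs : s 0 ≠ 0) (A : ℕ → ℕ → 𝕜) :
    (GenMeans.MapsInto A (GenMeans.c0Mean r s t) (GenMeans.c0 𝕜) ↔
      (∀ n, GenMeans.RConv r s t (A n)) ∧ GenMeans.RRowsBounded r s t A ∧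
        GenMeans.RColsNull r s t A ∧ GenMeans.WRowsBounded r s t A ∧
        GenMeans.WColsNull r s t A) ∧
    (GenMeans.MapsInto A (GenMeans.c0Mean r s t) (GenMeans.c 𝕜) ↔
      (∀ n, GenMeans.RConv r s t (A n)) ∧ GenMeans.RRowsBounded r s t A ∧
        GenMeans.WRowsBounded r s t A ∧ GenMeans.WColsNull r s t A ∧
        GenMeans.RColsConv r s t A) ∧
    (GenMeans.MapsInto A (GenMeans.c0Mean r s t) (GenMeans.linf 𝕜) ↔
      (∀ n, GenMeans.RConv r s t (A n)) ∧ GenMeans.RRowsBounded r s t A ∧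
        GenMeans.WRowsBounded r s t A ∧ GenMeans.WColsNull r s t A) ∧
    (∀ n k, GenMeans.SeriesConv (A n) → GenMeans.SeriesConv (GenMeans.rearrTerm s t (A n) k) →
      Tendsto (fun m => GenMeans.WRearr r s t (A n) m k) atTop (𝓝 0) →
      (GenMeans.SeriesConv fun j => GenMeans.invEntry r s t j k * A n j) ∧
        GenMeans.R r s t (A n) k = GenMeans.RRearr r s t (A n) k ∧
        ∀ m, k ≤ m → GenMeans.W r s t (A n) m k = GenMeans.WRearr r s t (A n) m k) := by
  exact ⟨GenMeans.mapsInto_c0_iff hr ht hs A, GenMeans.mapsInto_c_iff hr ht hs A,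
    GenMeans.mapsInto_linf_iff hr ht hs A, fun _ _ => GenMeans.rearrangement⟩
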